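/- Let $m\ge 1$ be an integer and let $(\alpha_i)_{i\ge m}$ be a sequence of positive real numbers; put $\alpha_j=0$ for $0\le j\le m-1$. A partial $m$-Dyck path is a lattice path in $\mathbb N\times\mathbb N$ with steps $(1,1)$ (rises, of weight $1$) and $(1,-m)$ ($m$-falls, of weight $\alpha_i$ when starting at height $i$); the weight of a path is the product of the weights of its steps. Let $S_{n,k}$ be the sum of the weights of all partial $m$-Dyck paths from $(0,0)$ to $((m+1)n,(m+1)k)$ (generalised $m$-Stieltjes-Rogers polynomials), and let $\hat S_{n,k}$ be the sum of the weights of those from $(0,0)$ to $((m+1)n+k,k)$ (modified $m$-Stieltjes-Rogers polynomials). Let $u_0,\dots,u_{m-1}$ be the linear functionals on $\mathbb R[x]$ with $\langle u_k,x^n\rangle=S_{n,k}$ for all $n\in\mathbb N$ and $0\le k\le m-1$. A sequence of real polynomials $(P_n)_{n\in\mathbb N}$ is $m$-orthogonal with respect to functionals $(w_0,\dots,w_{m-1})$ if, for every multi-index $(n_0,\dots,n_{m-1})\in\mathbb N^m$ with $n_0\ge n_1\ge\cdots\ge n_{m-1}\ge n_0-1$ and $n=n_0+\cdots+n_{m-1}$,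 the polynomial $P_n$ is monic of degree $n$ and $\langle w_j,x^kP_n\rangle=0$ for all $0\le j\le m-1$ and $0\le k<n_j$; $m$-orthogonality with respect to measures means $m$-orthogonality with respect to the functionals $f\mapsto\int f\,\mathrm d\mu_j$. Theorem. There is exactly one $m$-orthogonal sequence $(P_n)_{n\in\mathbb N}$ with respect to $(u_0,\dots,u_{m-1})$. Whenever $\mu_0,\dots,\mu_{m-1}$ are measures supported on subsets of $[0,\infty)$ all of whose moments exist, with $\int x^n\,\mathrm d\mu_k(x)=\hat S_{n,k}$ for all $n\in\mathbb N$ and $0\le k\le m-1$, a polynomial sequence is $m$-orthogonal with respect to $(\mu_0,\dots,\mu_{m-1})$ if and only if it is $m$-orthogonal with respect to $(u_0,\dots,u_{m-1})$. Moreover: 1. for every $n$, all (complex) zeros of $P_n$ are real, positive and simple; 2. the zeros of consecutive polynomials interlace: for every $n$, if $x_1<\cdots<x_n$ are the zeros of $P_n$ and $y_1<\cdots<y_{n+1}$ those of $P_{n+1}$, then $y_i<x_i<y_{i+1}$ for $1\le i\le n$; 3. $P_0=1$ and, for every $n\in\mathbb N$, $$P_{n+1}(x)=x\,P_n(x)-\sum_{k=0}^{\min(m,n)}\gamma_{n-k}^{[k]}\,P_{n-k}(x),\qquad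 \gamma_n^{[k]}=\sum_{m\ge\lambda_0>\cdots>\lambda_k\ge 0}\ \prod_{j=0}^{k}\alpha_{(m+1)(n+j)+\lambda_j},$$ and $\gamma_n^{[k]}>0$ for all $n\in\mathbb N$ and $0\le k\le m$. -/

import Mathlib

open MeasureTheory Polynomial

noncomputable section

namespace BranchedCF

/-- Height reached after `t` steps by the lattice path that starts at `(0, 0)` and whose `i`-th step
is the rise `(1, 1)` if `s i = true` and the `m`-fall `(1, -m)` if `s i = false`. -/
def height (m : ℕ) {N : ℕ} (s : Fin N → Bool) (t : ℕ) : ℤ :=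
  ∑ i : Fin N, if i.val < t then (if s i = true then (1 : ℤ) else -(m : ℤ)) else 0

/-- The path coded by `s` is a partial `m`-Dyck path from `(0, 0)` to `(N, h)`: all its vertices lie
in `ℕ × ℕ`. -/
def IsPartialDyckPath (m : ℕ) {N : ℕ} (s : Fin N → Bool) (h : ℕ) : Prop :=
  (∀ t : ℕ, t ≤ N → 0 ≤ height m s t) ∧ height m s N = (h : ℤ)

/-- Weight of a path: rises have weight `1`, an `m`-fall from height `i` has weight `α i`. -/
def pathWeight (m : ℕ) (α : ℕ → ℝ) {N : ℕ} (s : Fin N → Bool) : ℝ :=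
  ∏ i : Fin N, if s i = true then 1 else α (height m s i.val).toNat

open Classical in
/-- Generating polynomial of the partial `m`-Dyck paths from `(0, 0)` to `(N, h)`. -/
def dyckSum (m : ℕ) (α : ℕ → ℝ) (N h : ℕ) : ℝ :=
  ∑ s : Fin N → Bool with IsPartialDyckPath m s h, pathWeight m α s

/-- Generalised `m`-Stieltjes-Rogers polynomial `S_{n,k}^{(m)}(α)`. -/
def generalisedSR (m : ℕ) (α : ℕ → ℝ) (n k : ℕ) : ℝ :=
  dyckSum m α ((m + 1) * n) ((m + 1) * k)

/-- Modified `m`-Stieltjes-Rogers polynomial `S_n^{(m;k)}(α)` of type `k`. -/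
def modifiedSR (m : ℕ) (α : ℕ → ℝ) (n k : ℕ) : ℝ :=
  dyckSum m α ((m + 1) * n + k) k

/-- `P` is a type II multiple orthogonal polynomial for the multi-index `v` with respect to the
functionals with actions `f ↦ u j f`. -/
def IsTypeII {d : ℕ} (u : Fin d → ℝ[X] → ℝ) (v : Fin d → ℕ) (P : ℝ[X]) : Prop :=
  P.Monic ∧ P.natDegree = ∑ j, v j ∧ ∀ j : Fin d, ∀ k : ℕ, k < v j → u j (X ^ k * P) = 0

/-- The multi-index `v` is on the step-line: `v 0 ≥ v 1 ≥ ⋯ ≥ v (d - 1) ≥ v 0 - 1`. -/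
def OnStepLine {d : ℕ} (v : Fin d → ℕ) : Prop :=
  ∀ i j : Fin d, i ≤ j → v j ≤ v i ∧ v i ≤ v j + 1

/-- The sequence `P` is `d`-orthogonal with respect to `u`: `P n` is the type II multiple orthogonal
polynomial for the multi-index of norm `n` on the step-line. -/
def IsDOrthogonal {d : ℕ} (u : Fin d → ℝ[X] → ℝ) (P : ℕ → ℝ[X]) : Prop :=
  ∀ v : Fin d → ℕ, OnStepLine v → IsTypeII u v (P (∑ j, v j))

/-- Action on polynomials of the functional induced by a measure. -/
def measureFunctional (μ : Measure ℝ) (f : ℝ[X]) : ℝ :=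
  ∫ x, f.eval x ∂μ

/-- The sequence `α` with the entries of index less than `m` set to `0`. -/
def alphaZero (m : ℕ) (α : ℕ → ℝ) (j : ℕ) : ℝ :=
  if j < m then 0 else α j

open Classical in
/-- The coefficient `γ_n^{[k]}`: the sum over `m ≥ l 0 > ⋯ > l k ≥ 0` of
`∏_{j=0}^{k} α_{(m+1)(n+j) + l j}`. -/
def gammaCoeff (m : ℕ) (α : ℕ → ℝ) (n k : ℕ) : ℝ :=
  ∑ l : Fin (k + 1) → Fin (m + 1) with StrictAnti l,
    ∏ j : Fin (k + 1), alphaZero m α ((m + 1) * (n + j.val) + (l j).val)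

/-- `p` has exactly `n` distinct real zeros `x`, `q` has exactly `n + 1` distinct real zeros `y`, and
`y 0 < x 0 < y 1 < x 1 < ⋯ < x (n - 1) < y n`. -/
def ZerosInterlace (n : ℕ) (p q : ℝ[X]) : Prop :=
  ∃ (x : Fin n → ℝ) (y : Fin (n + 1) → ℝ), StrictMono x ∧ StrictMono y ∧
    Set.range x = {t : ℝ | p.IsRoot t} ∧ Set.range y = {t : ℝ | q.IsRoot t} ∧
    ∀ i : Fin n, y i.castSucc < x i ∧ x i < y i.succ

end BranchedCF

end

/-!
Refine the sequence `P n` to a family `heightPoly m α n r`, `0 ≤ r ≤ m`, one polynomial for each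
height `h = (m + 1) * n + r`, such that multiplication by `t = x ^ (1 / (m + 1))` moves from height
`h` to `h + 1` with coefficient `1` and to `h - m` with coefficient `α h`: exactly one step of an
`m`-Dyck path. The sequence of the theorem is `P n = heightPoly m α n 0`, and everything follows
from this refinement.

*Recurrence.* Multiplying by `x` is a walk of `m + 1` steps. Sorting these walks by the number of
falls gives the recurrence with the coefficients `γ` (`X_mul_heightPoly_zero`), where `γ` is
positive because each summand is nonnegative and one of them is a product of positive weights.

*Orthogonality.* A power of `x` is a walk from height `0`, so its expansion in the polynomials
attached to the heights has the path sums as coefficients (`X_pow_eq_sum_dyckSum`). A functional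
whose moments count the paths that end at height `K` is therefore dual to these polynomials at the
heights congruent to `K` (`apply_heightPolyAt`). For `u k` this says `u k (P n) = δ_{kn}`; for the
measures it gives, after descending from the residue `k` to the residue `0`, that the integral of
`P n` vanishes for `n > k` and is positive for `n = k` (`apply_of_modifiedSR`). Such triangularity,
together with the recurrence and `γ n m ≠ 0`, already forces `P` to be the unique `m`-orthogonal
sequence (`isDOrthogonal_iff_eq`). As both systems are triangular on the same `P`, they have the
same `m`-orthogonal sequence.

*Zeros.* No theory of oscillation matrices is needed. On the whole real line the Wronskians
`p * q' - p' * q` of neighbouring members of the refined family, and those of `p` with `X * q`, keep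
their signs (`wronskian_heightPoly`), since each new member is a combination of old ones with known
signs. Thus the Wronskian of `P n` and `P (n + 1)` is positive everywhere, so `P n / P (n + 1)`
is decreasing between its poles. With the sign of `P n` on `(-∞, 0]`, this puts a zero of
`P (n + 1)` into each of the `n + 1` intervals into which the zeros of `P n` divide `(0, ∞)`
(`exists_interlacing_zeros`), and an induction on `n` gives that all zeros are positive, simple and
interlacing.
-/

noncomputable section

namespace BranchedCF


/-! ### Counting paths by their last step -/

lemma height_snoc_of_le (m : ℕ) {N : ℕ} (s : Fin N → Bool) (b : Bool) {t : ℕ} (ht : t ≤ N) :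
    height m (Fin.snoc s b : Fin (N + 1) → Bool) t = height m s t := by
  simp [height, Fin.sum_univ_castSucc, Nat.not_lt.mpr ht]

lemma height_snoc_last (m : ℕ) {N : ℕ} (s : Fin N → Bool) (b : Bool) :
    height m (Fin.snoc s b : Fin (N + 1) → Bool) (N + 1) =
      height m s N + if b = true then (1 : ℤ) else -(m : ℤ) := by
  simp [height, Fin.sum_univ_castSucc]

lemma pathWeight_snoc (m : ℕ) (α : ℕ → ℝ) {N : ℕ} (s : Fin N → Bool) (b : Bool) :
    pathWeight m α (Fin.snoc s b : Fin (N + 1) → Bool) =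
      pathWeight m α s * if b = true then 1 else α (height m s N).toNat := by
  simp only [pathWeight, Fin.prod_univ_castSucc, Fin.snoc_castSucc, Fin.snoc_last, Fin.val_castSucc,
    Fin.val_last, height_snoc_of_le m s b le_rfl]
  congr 1
  refine Finset.prod_congr rfl fun i _ => ?_
  rw [height_snoc_of_le m s b i.isLt.le]

lemma isPartialDyckPath_snoc (m : ℕ) {N : ℕ} (s : Fin N → Bool) (b : Bool) (h : ℕ) :
    IsPartialDyckPath m (Fin.snoc s b : Fin (N + 1) → Bool) h ↔
      (∀ t ≤ N, 0 ≤ height m s t) ∧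
        height m s N + (if b = true then (1 : ℤ) else -(m : ℤ)) = h := by
  unfold IsPartialDyckPath
  rw [height_snoc_last]
  refine and_congr_left fun hh => ⟨fun H t ht => ?_, fun H t ht => ?_⟩
  · rw [← height_snoc_of_le m s b ht]
    exact H t (by omega)
  · rcases Nat.lt_or_ge N t with h1 | h1
    · obtain rfl : t = N + 1 := by omega
      rw [height_snoc_last, hh]
      positivity
    · rw [height_snoc_of_le m s b h1]
      exact H t h1

lemma isPartialDyckPath_snoc_fall (m : ℕ) {N : ℕ} (s : Fin N → Bool) (h : ℕ) :
    IsPartialDyckPath m (Fin.snoc s false : Fin (N + 1) → Bool) h ↔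
      IsPartialDyckPath m s (h + m) := by
  rw [isPartialDyckPath_snoc]
  refine and_congr_right fun _ => ?_
  simp only [Bool.false_eq_true, if_false, Nat.cast_add]
  omega

lemma isPartialDyckPath_snoc_rise (m : ℕ) {N : ℕ} (s : Fin N → Bool) (h : ℕ) :
    IsPartialDyckPath m (Fin.snoc s true : Fin (N + 1) → Bool) (h + 1) ↔
      IsPartialDyckPath m s h := by
  rw [isPartialDyckPath_snoc]
  refine and_congr_right fun _ => ?_
  simp

lemma not_isPartialDyckPath_snoc_rise_zero (m : ℕ) {N : ℕ} (s : Fin N → Bool) :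
    ¬ IsPartialDyckPath m (Fin.snoc s true : Fin (N + 1) → Bool) 0 := by
  rw [isPartialDyckPath_snoc]
  rintro ⟨h1, h2⟩
  have := h1 N le_rfl
  simp at h2
  omega

open Classical in
lemma dyckSum_succ_eq (m : ℕ) (α : ℕ → ℝ) (N h : ℕ) :
    dyckSum m α (N + 1) h =
      (∑ s : Fin N → Bool,
        if IsPartialDyckPath m (Fin.snoc s true : Fin (N + 1) → Bool) h then pathWeight m α s
        else 0) + α (h + m) * dyckSum m α N (h + m) := by
  unfold dyckSum
  rw [Finset.sum_filter, Finset.sum_filter, ← (Fin.snocEquiv fun _ => Bool).sum_comp,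
    Fintype.sum_prod_type, Fintype.sum_bool, Finset.mul_sum]
  congr 1
  · refine Finset.sum_congr rfl fun s _ => ?_
    have := pathWeight_snoc m α s true
    rw [if_pos rfl, mul_one] at this
    rw [← this]
    rfl
  · refine Finset.sum_congr rfl fun s _ => ?_
    have := pathWeight_snoc m α s false
    rw [if_neg (by simp)] at this
    change (if IsPartialDyckPath m (Fin.snoc s false : Fin (N + 1) → Bool) h then
      pathWeight m α (Fin.snoc s false : Fin (N + 1) → Bool) else 0) = _
    rw [this]
    simp only [isPartialDyckPath_snoc_fall]
    split_ifs with h1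
    · rw [h1.2, Int.toNat_natCast, mul_comm]
    · simp

lemma dyckSum_succ_zero (m : ℕ) (α : ℕ → ℝ) (N : ℕ) :
    dyckSum m α (N + 1) 0 = α m * dyckSum m α N m := by
  rw [dyckSum_succ_eq]
  simp [not_isPartialDyckPath_snoc_rise_zero]

lemma dyckSum_succ_succ (m : ℕ) (α : ℕ → ℝ) (N h : ℕ) :
    dyckSum m α (N + 1) (h + 1) =
      dyckSum m α N h + α (h + 1 + m) * dyckSum m α N (h + 1 + m) := by
  classical
  rw [dyckSum_succ_eq]
  congr 1
  simp only [isPartialDyckPath_snoc_rise]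
  rw [dyckSum, Finset.sum_filter]

lemma dyckSum_zero_right (m : ℕ) (α : ℕ → ℝ) (h : ℕ) :
    dyckSum m α 0 h = if h = 0 then 1 else 0 := by
  classical
  have (s : Fin 0 → Bool) : IsPartialDyckPath m s h ↔ h = 0 := by
    simp only [IsPartialDyckPath, height, Finset.univ_eq_empty, Finset.sum_empty]
    exact ⟨fun H => by exact_mod_cast H.2.symm, fun H => ⟨fun _ _ => le_rfl, by simp [H]⟩⟩
  rw [dyckSum, Finset.sum_filter]
  simp [this, pathWeight]

lemma dyckSum_eq_zero_of_lt (m : ℕ) (α : ℕ → ℝ) {N h : ℕ} (hN : N < h) :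
    dyckSum m α N h = 0 := by
  induction N generalizing h with
  | zero => rw [dyckSum_zero_right, if_neg (by omega)]
  | succ N ih =>
    obtain ⟨h, rfl⟩ : ∃ k, h = k + 1 := ⟨h - 1, by omega⟩
    rw [dyckSum_succ_succ, ih (by omega), ih (by omega)]
    simp

lemma dyckSum_self (m : ℕ) (α : ℕ → ℝ) (N : ℕ) : dyckSum m α N N = 1 := by
  induction N with
  | zero => simp [dyckSum_zero_right]
  | succ N ih => rw [dyckSum_succ_succ, ih, dyckSum_eq_zero_of_lt m α (by omega)]; simp

/-- Both steps change the height by `1` modulo `m + 1`. -/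
lemma dyckSum_eq_zero_of_not_modEq (m : ℕ) (α : ℕ → ℝ) {N h : ℕ} (hN : ¬ h ≡ N [MOD m + 1]) :
    dyckSum m α N h = 0 := by
  induction N generalizing h with
  | zero =>
    rw [dyckSum_zero_right, if_neg]
    rintro rfl
    exact hN rfl
  | succ N ih =>
    have key : dyckSum m α N (h + m) = 0 := by
      refine ih fun H => hN ?_
      have := H.add_right 1
      rw [add_assoc] at this
      exact (by simp [Nat.ModEq] : h ≡ h + (m + 1) [MOD m + 1]).trans this
    cases h with
    | zero => rw [dyckSum_succ_zero, ← zero_add m, zero_add m]; simpa using Or.inr key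
    | succ h =>
      rw [dyckSum_succ_succ, key, ih fun H => hN (H.add_right 1)]
      simp


/-! ### The polynomials attached to the heights -/

/-- The polynomial attached to the height `h = (m + 1) * n + r` with `r ≤ m`: evaluated at
`x = t ^ (m + 1)` and multiplied by `t ^ r`, it is the polynomial `Q h` in `t` generated by
`t * Q h = Q (h + 1) + α h * Q (h - m)`, where the term with `Q (h - m)` is absent for `h < m`.
The values at `r > m` have no such meaning and are not used. -/
def heightPoly (m : ℕ) (α : ℕ → ℝ) : ℕ → ℕ → ℝ[X]
  | 0, _ => 1
  | n + 1, 0 => X * heightPoly m α n m - C (α ((m + 1) * n + m)) * heightPoly m α n 0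
  | n + 1, r + 1 => heightPoly m α (n + 1) r -
      C (α ((m + 1) * (n + 1) + r)) * heightPoly m α n (r + 1)
termination_by n r => (n, r)

lemma heightPoly_zero (m : ℕ) (α : ℕ → ℝ) (r : ℕ) : heightPoly m α 0 r = 1 := by
  rw [heightPoly]

lemma heightPoly_succ_zero (m : ℕ) (α : ℕ → ℝ) (n : ℕ) :
    heightPoly m α (n + 1) 0 =
      X * heightPoly m α n m - C (α ((m + 1) * n + m)) * heightPoly m α n 0 := by
  rw [heightPoly]

lemma heightPoly_succ_succ (m : ℕ) (α : ℕ → ℝ) (n r : ℕ) :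
    heightPoly m α (n + 1) (r + 1) = heightPoly m α (n + 1) r -
      C (α ((m + 1) * (n + 1) + r)) * heightPoly m α n (r + 1) := by
  rw [heightPoly]

lemma heightPoly_monic_and_natDegree (m : ℕ) (α : ℕ → ℝ) (n r : ℕ) :
    (heightPoly m α n r).Monic ∧ (heightPoly m α n r).natDegree = n := by
  have key {p q : ℝ[X]} {a : ℝ} {k : ℕ} (hp : p.Monic ∧ p.natDegree = k + 1)
      (hq : q.Monic ∧ q.natDegree = k) :
      (p - C a * q).Monic ∧ (p - C a * q).natDegree = k + 1 := by
    have hlt : (C a * q).natDegree < p.natDegree := by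
      have := natDegree_C_mul_le a q
      omega
    refine ⟨hp.1.sub_of_left (degree_lt_degree hlt), ?_⟩
    rw [natDegree_sub_eq_left_of_natDegree_lt hlt, hp.2]
  induction n generalizing r with
  | zero => simp [heightPoly_zero]
  | succ n ih =>
    induction r with
    | zero =>
      rw [heightPoly_succ_zero]
      refine key ⟨monic_X.mul (ih m).1, ?_⟩ (ih 0)
      rw [monic_X.natDegree_mul (ih m).1, natDegree_X, (ih m).2, add_comm]
    | succ r ihr =>
      rw [heightPoly_succ_succ]
      exact key ihr (ih _)

/-! ### Wronskians -/

lemma pos_of_le {m : ℕ} {α : ℕ → ℝ} (hα : ∀ k : ℕ, 0 < α (k + m)) {k : ℕ} (hk : m ≤ k) :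
    0 < α k := by
  simpa [Nat.sub_add_cancel hk] using hα (k - m)

lemma wronskian_sub_C_mul_right (p q s : ℝ[X]) (a : ℝ) :
    wronskian p (q - C a * s) = wronskian p q + C a * wronskian s p := by
  simp only [wronskian, derivative_sub, derivative_mul, derivative_C]
  ring

/-- Signs of the Wronskians within the row `n`. The induction on `n` also carries the signs of the
Wronskians between the rows `n` and `n + 1`. The Wronskians with a factor `X` are needed because
`heightPoly m α (n + 1) 0` is built from `X * heightPoly m α n m`. -/
lemma wronskian_heightPoly (m : ℕ) (α : ℕ → ℝ) (hα : ∀ k : ℕ, 0 < α (k + m)) (x : ℝ) (n : ℕ) :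
    ∀ r s, r ≤ s → s ≤ m → 0 ≤ (wronskian (heightPoly m α n r) (heightPoly m α n s)).eval x ∧
      0 ≤ (wronskian (heightPoly m α n r) (X * heightPoly m α n s)).eval x ∧
      (r < s → 0 < (wronskian (heightPoly m α n r) (X * heightPoly m α n s)).eval x) := by
  have hXX (p q : ℝ[X]) : wronskian (X * p) (X * q) = X ^ 2 * wronskian p q := by
    simp only [wronskian, derivative_mul, derivative_X]
    ring
  have hself (p : ℝ[X]) : (wronskian p (X * p)).eval x = p.eval x ^ 2 := by
    simp only [wronskian, derivative_mul, derivative_X, eval_sub, eval_mul, eval_add, eval_X,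
      eval_one]
    ring
  have hneg (p q s : ℝ[X]) (a : ℝ) :
      wronskian p (X * (q - C a * s)) = wronskian p (X * q) + C a * wronskian (X * s) p := by
    simp only [wronskian, derivative_mul, derivative_X, derivative_sub, derivative_C]
    ring
  induction n with
  | zero =>
    intro r s _ _
    simp [heightPoly_zero, wronskian]
  | succ n ih =>
    -- The entry `s` of the row `n + 1` against the earlier entries of its row, and against the
    -- later entries of the row `n`.
    have main : ∀ s ≤ m,
        (∀ r ≤ s, 0 ≤ (wronskian (heightPoly m α (n + 1) r) (heightPoly m α (n + 1) s)).eval x ∧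
          0 ≤ (wronskian (heightPoly m α (n + 1) r) (X * heightPoly m α (n + 1) s)).eval x ∧
          (r < s →
            0 < (wronskian (heightPoly m α (n + 1) r) (X * heightPoly m α (n + 1) s)).eval x)) ∧
        (∀ r, s < r → r ≤ m →
          0 ≤ (wronskian (heightPoly m α n r) (heightPoly m α (n + 1) s)).eval x ∧
          0 < (wronskian (X * heightPoly m α n r) (heightPoly m α (n + 1) s)).eval x) := by
      intro s
      induction s using Nat.strong_induction_on with
      | _ s ihs =>
      intro hs
      cases s with
      | zero =>
        have ha := pos_of_le hα (k := (m + 1) * n + m) (by omega)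
        constructor
        · intro r hr
          obtain rfl : r = 0 := by omega
          rw [hself, wronskian_self_eq_zero]
          simp [sq_nonneg]
        · intro r h0 hr
          rw [heightPoly_succ_zero, wronskian_sub_C_mul_right, wronskian_sub_C_mul_right, hXX]
          have h1 := ih r m hr le_rfl
          have h2 := ih 0 r h0.le hr
          simp only [eval_add, eval_mul, eval_C, eval_pow, eval_X]
          have h3 := mul_pos ha (h2.2.2 h0)
          have h4 := mul_nonneg ha.le h2.1
          have h5 := mul_nonneg (sq_nonneg x) h1.1
          exact ⟨by linarith [h1.2.1], by linarith⟩
      | succ s =>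
        have ha := pos_of_le hα (k := (m + 1) * (n + 1) + s) (by nlinarith)
        obtain ⟨i1, i2⟩ := ihs s (by omega) (by omega)
        constructor
        · intro r hr
          rcases Nat.lt_or_ge s r with h | h
          · obtain rfl : r = s + 1 := by omega
            rw [hself, wronskian_self_eq_zero]
            simp [sq_nonneg]
          · rw [heightPoly_succ_succ, wronskian_sub_C_mul_right, hneg]
            have h1 := i1 r h
            have h2 := (ihs r (by omega) (by omega)).2 (s + 1) (by omega) hs
            simp only [eval_add, eval_mul, eval_C]
            have h3 := mul_nonneg ha.le h2.1
            have h4 := mul_pos ha h2.2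
            exact ⟨by linarith [h1.1], by linarith [h1.2.1], fun _ => by linarith [h1.2.1]⟩
        · intro r h hr
          rw [heightPoly_succ_succ, wronskian_sub_C_mul_right, wronskian_sub_C_mul_right]
          have h1 := i2 r (by omega) hr
          have h2 := ih (s + 1) r h.le hr
          simp only [eval_add, eval_mul, eval_C]
          have h3 := mul_nonneg ha.le h2.1
          have h4 := mul_pos ha (h2.2.2 h)
          exact ⟨by linarith [h1.1], by linarith [h1.2]⟩
    exact fun r s h hs => (main s hs).1 r h


/-! ### Zeros -/

lemma alternating_heightPoly (m : ℕ) (α : ℕ → ℝ) (hα : ∀ k : ℕ, 0 < α (k + m)) {x : ℝ}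
    (hx : x ≤ 0) (n r : ℕ) : 0 < (-1) ^ n * (heightPoly m α n r).eval x := by
  induction n generalizing r with
  | zero => simp [heightPoly_zero]
  | succ n ih =>
    induction r with
    | zero =>
      have ha := mul_pos (pos_of_le hα (k := (m + 1) * n + m) (by omega)) (ih 0)
      have hb := mul_nonneg (neg_nonneg.mpr hx) (ih m).le
      rw [heightPoly_succ_zero, pow_succ]
      simp only [eval_sub, eval_mul, eval_X, eval_C]
      linarith
    | succ r ihr =>
      rw [heightPoly_succ_succ]
      by_cases hk : m ≤ (m + 1) * (n + 1) + r
      · have ha := mul_pos (pos_of_le hα hk) (ih (r + 1))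
        rw [pow_succ] at ihr ⊢
        simp only [eval_sub, eval_mul, eval_C]
        linarith
      · nlinarith

/-- If `q` had no zero in `(a, b)`, then `p / q` would be strictly decreasing on `[a, b]`. -/
lemma exists_root_of_wronskian_pos {p q : ℝ[X]} (hW : ∀ t, 0 < (wronskian p q).eval t) {a b : ℝ}
    (hab : a < b) (ha : q.eval a ≠ 0) (hb : q.eval b ≠ 0)
    (hle : p.eval a / q.eval a ≤ p.eval b / q.eval b) : ∃ c ∈ Set.Ioo a b, q.IsRoot c := by
  by_contra! hq
  have hne : ∀ t ∈ Set.Icc a b, q.eval t ≠ 0 := by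
    intro t ht
    rcases ht.1.eq_or_lt with rfl | h1
    · exact ha
    rcases ht.2.eq_or_lt with rfl | h2
    · exact hb
    exact hq t ⟨h1, h2⟩
  have hanti : StrictAntiOn (fun t => p.eval t / q.eval t) (Set.Icc a b) := by
    refine strictAntiOn_of_deriv_neg (convex_Icc a b)
      (p.continuousOn.div q.continuousOn hne) fun t ht => ?_
    rw [interior_Icc] at ht
    have h := hne t (Set.Ioo_subset_Icc_self ht)
    rw [((p.hasDerivAt t).fun_div (q.hasDerivAt t) h).deriv]
    have := hW t
    simp only [wronskian, eval_sub, eval_mul] at this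
    exact div_neg_of_neg_of_pos (by linarith) (by positivity)
  exact (hanti (Set.left_mem_Icc.2 hab.le) (Set.right_mem_Icc.2 hab.le) hab).not_ge hle

lemma eq_prod_X_sub_C {n : ℕ} {q : ℝ[X]} (hq : q.Monic) (hd : q.natDegree = n) {y : Fin n → ℝ}
    (hy : Function.Injective y) (hr : ∀ i, q.IsRoot (y i)) : q = ∏ i, (X - C (y i)) := by
  have hm : (∏ i, (X - C (y i))).Monic := monic_prod_of_monic _ _ fun i _ => monic_X_sub_C _
  have hdvd : ∏ i, (X - C (y i)) ∣ q :=
    Finset.prod_dvd_of_coprime (fun i _ j _ hij => pairwise_coprime_X_sub_C hy hij)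
      fun i _ => dvd_iff_isRoot.2 (hr i)
  refine (eq_of_monic_of_dvd_of_natDegree_le hm hq hdvd ?_)
  rw [natDegree_prod_of_monic _ _ fun i _ => monic_X_sub_C _]
  simp [hd]

/-- Because `p / q` is strictly decreasing between the zeros of `q`, the polynomial `q` has a zero
in each of the `n + 1` intervals into which the zeros of `p` divide the positive half-line. -/
lemma exists_interlacing_zeros {n : ℕ} {p q : ℝ[X]} {x : Fin n → ℝ} (hx : StrictMono x)
    (hx0 : ∀ i, 0 < x i) (hp : p = ∏ i, (X - C (x i))) (hq : q.Monic) (hd : q.natDegree = n + 1)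
    (hW : ∀ t, 0 < (wronskian p q).eval t) (h0 : p.eval 0 * q.eval 0 < 0) :
    ∃ y : Fin (n + 1) → ℝ, StrictMono y ∧ (∀ i, 0 < y i) ∧
      (∀ i : Fin n, y i.castSucc < x i ∧ x i < y i.succ) ∧ q = ∏ i, (X - C (y i)) := by
  obtain ⟨M, hM0, hMx, hMq⟩ : ∃ M : ℝ, 0 < M ∧ (∀ i, x i < M) ∧ 0 < q.eval M := by
    have hlim : Filter.Tendsto (fun t => q.eval t) Filter.atTop Filter.atTop :=
      q.tendsto_atTop_of_leadingCoeff_nonneg (natDegree_pos_iff_degree_pos.1 (by omega))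
        (by simp [hq.leadingCoeff])
    exact ((Filter.eventually_gt_atTop 0).and ((Filter.eventually_all.2 fun i =>
      Filter.eventually_gt_atTop (x i)).and (hlim.eventually_gt_atTop 0))).exists
  have hMp : 0 < p.eval M := by
    rw [hp, eval_prod]
    exact Finset.prod_pos fun i _ => by simpa using hMx i
  have hpx (i : Fin n) : p.eval (x i) = 0 := by
    rw [hp, eval_prod]
    exact Finset.prod_eq_zero (Finset.mem_univ i) (by simp)
  have hqx (i : Fin n) : q.eval (x i) ≠ 0 := by
    intro h
    have := hW (x i)
    simp [wronskian, h, hpx] at this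
  have hq0 : q.eval 0 ≠ 0 := by
    rintro h
    simp [h] at h0
  have hf0 : p.eval 0 / q.eval 0 ≤ 0 := by
    rw [← mul_div_mul_right _ _ hq0]
    exact div_nonpos_of_nonpos_of_nonneg h0.le (mul_self_nonneg _)
  have hfM : 0 ≤ p.eval M / q.eval M := by positivity
  -- The `n + 1` intervals: the zeros of `p` together with the end points `0` and `M`.
  let Z : Fin (n + 2) → ℝ := Fin.cons 0 (Fin.snoc x M)
  have hZx (i : Fin n) : Z i.castSucc.succ = x i := by simp [Z]
  have hZM : Z (Fin.last n).succ = M := by simp [Z]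
  have hroot (i : Fin (n + 1)) : ∃ c ∈ Set.Ioo (Z i.castSucc) (Z i.succ), q.IsRoot c := by
    have hl : Z i.castSucc = 0 ∨ ∃ j, Z i.castSucc = x j ∧ j.succ = i := by
      refine Fin.cases (Or.inl rfl) (fun j => Or.inr ⟨j, ?_, rfl⟩) i
      rw [← Fin.succ_castSucc, hZx]
    have hr : Z i.succ = M ∨ ∃ j, Z i.succ = x j ∧ j.castSucc = i :=
      Fin.lastCases (Or.inl hZM) (fun j => Or.inr ⟨j, hZx j, rfl⟩) i
    rcases hl with hl | ⟨j, hl, hj⟩ <;> rcases hr with hr | ⟨k, hr, hk⟩ <;> rw [hl, hr]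
    · exact exists_root_of_wronskian_pos hW hM0 hq0 hMq.ne' (hf0.trans hfM)
    · refine exists_root_of_wronskian_pos hW (hx0 k) hq0 (hqx k) ?_
      simpa [hpx] using hf0
    · refine exists_root_of_wronskian_pos hW (hMx j) (hqx j) hMq.ne' ?_
      simpa [hpx] using hfM
    · refine exists_root_of_wronskian_pos hW (hx ?_) (hqx j) (hqx k) (by simp [hpx])
      have := congrArg Fin.val (hj.trans hk.symm)
      simp only [Fin.val_succ, Fin.val_castSucc] at this
      exact Fin.lt_def.2 (by omega)
  choose y hy hyr using hroot
  have hint (i : Fin n) : y i.castSucc < x i ∧ x i < y i.succ := by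
    have h1 := (hy i.castSucc).2
    have h2 := (hy i.succ).1
    rw [hZx] at h1
    rw [← Fin.succ_castSucc, hZx] at h2
    exact ⟨h1, h2⟩
  have hmono : StrictMono y := Fin.strictMono_iff_lt_succ.2 fun i => (hint i).1.trans (hint i).2
  refine ⟨y, hmono, fun i => ?_, hint, eq_prod_X_sub_C hq hd hmono.injective hyr⟩
  exact (hy 0).1.trans_le (hmono.monotone (Fin.zero_le i))

lemma wronskian_heightPoly_zero_pos {m : ℕ} (hm : 0 < m) {α : ℕ → ℝ}
    (hα : ∀ k : ℕ, 0 < α (k + m)) (n : ℕ) (x : ℝ) :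
    0 < (wronskian (heightPoly m α n 0) (heightPoly m α (n + 1) 0)).eval x := by
  rw [heightPoly_succ_zero, wronskian_sub_C_mul_right, wronskian_self_eq_zero]
  simpa using (wronskian_heightPoly m α hα x n 0 m hm.le le_rfl).2.2 hm

lemma eval_zero_heightPoly_mul_neg (m : ℕ) {α : ℕ → ℝ} (hα : ∀ k : ℕ, 0 < α (k + m)) (n : ℕ) :
    (heightPoly m α n 0).eval 0 * (heightPoly m α (n + 1) 0).eval 0 < 0 := by
  have h := mul_pos (alternating_heightPoly m α hα le_rfl n 0)
    (alternating_heightPoly m α hα le_rfl (n + 1) 0)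
  have h2 : (-1 : ℝ) ^ n * (-1) ^ n = 1 := by rw [← mul_pow]; simp
  rw [pow_succ] at h
  have h3 : (-1) ^ n * (heightPoly m α n 0).eval 0 *
      ((-1) ^ n * -1 * (heightPoly m α (n + 1) 0).eval 0) =
      -((heightPoly m α n 0).eval 0 * (heightPoly m α (n + 1) 0).eval 0) := by
    linear_combination -((heightPoly m α n 0).eval 0 * (heightPoly m α (n + 1) 0).eval 0) * h2
  linarith

lemma exists_pos_zeros_heightPoly {m : ℕ} (hm : 0 < m) {α : ℕ → ℝ}
    (hα : ∀ k : ℕ, 0 < α (k + m)) (n : ℕ) :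
    ∃ x : Fin n → ℝ, StrictMono x ∧ (∀ i, 0 < x i) ∧
      heightPoly m α n 0 = ∏ i, (X - C (x i)) := by
  induction n with
  | zero => exact ⟨Fin.elim0, fun i => i.elim0, fun i => i.elim0, by simp [heightPoly_zero]⟩
  | succ n ih =>
    obtain ⟨x, hx, hx0, hp⟩ := ih
    obtain ⟨y, hy, hy0, -, hq⟩ := exists_interlacing_zeros hx hx0 hp
      (heightPoly_monic_and_natDegree m α (n + 1) 0).1
      (heightPoly_monic_and_natDegree m α (n + 1) 0).2
      (wronskian_heightPoly_zero_pos hm hα n) (eval_zero_heightPoly_mul_neg m hα n)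
    exact ⟨y, hy, hy0, hq⟩

lemma range_eq_setOf_isRoot {n : ℕ} {p : ℝ[X]} {x : Fin n → ℝ} (hp : p = ∏ i, (X - C (x i))) :
    Set.range x = {t | p.IsRoot t} := by
  ext t
  simp [hp, IsRoot, eval_prod, Finset.prod_eq_zero_iff, sub_eq_zero, eq_comm (a := t)]

lemma zerosInterlace_heightPoly {m : ℕ} (hm : 0 < m) {α : ℕ → ℝ}
    (hα : ∀ k : ℕ, 0 < α (k + m)) (n : ℕ) :
    ZerosInterlace n (heightPoly m α n 0) (heightPoly m α (n + 1) 0) := by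
  obtain ⟨x, hx, hx0, hp⟩ := exists_pos_zeros_heightPoly hm hα n
  obtain ⟨y, hy, hy0, hint, hq⟩ := exists_interlacing_zeros hx hx0 hp
    (heightPoly_monic_and_natDegree m α (n + 1) 0).1
    (heightPoly_monic_and_natDegree m α (n + 1) 0).2
    (wronskian_heightPoly_zero_pos hm hα n) (eval_zero_heightPoly_mul_neg m hα n)
  exact ⟨x, y, hx, hy, range_eq_setOf_isRoot hp, range_eq_setOf_isRoot hq, hint⟩

lemma complex_zeros_heightPoly {m : ℕ} (hm : 0 < m) {α : ℕ → ℝ}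
    (hα : ∀ k : ℕ, 0 < α (k + m)) (n : ℕ) {z : ℂ}
    (hz : ((heightPoly m α n 0).map (algebraMap ℝ ℂ)).IsRoot z) :
    z.im = 0 ∧ 0 < z.re ∧
      ((heightPoly m α n 0).map (algebraMap ℝ ℂ)).rootMultiplicity z = 1 := by
  obtain ⟨x, hx, hx0, hp⟩ := exists_pos_zeros_heightPoly hm hα n
  have hmap : (heightPoly m α n 0).map (algebraMap ℝ ℂ) = ∏ i, (X - C (x i : ℂ)) := by
    simp [hp, Polynomial.map_prod]
  rw [hmap] at hz ⊢
  obtain ⟨i, hi⟩ : ∃ i, (x i : ℂ) = z := by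
    simpa [IsRoot, eval_prod, Finset.prod_eq_zero_iff, sub_eq_zero, eq_comm (a := z)] using hz
  refine ⟨by simp [← hi], by simpa [← hi] using hx0 i, ?_⟩
  have hinj : Function.Injective fun i => (x i : ℂ) := Complex.ofReal_injective.comp hx.injective
  exact (rootMultiplicity_le_one_of_separable (separable_prod_X_sub_C_iff.2 hinj) z).antisymm
    ((rootMultiplicity_pos (monic_prod_of_monic _ _ fun i _ => monic_X_sub_C _).ne_zero).2 hz)


/-! ### The recurrence relation -/

/-- Sum of the weights of `k` falls at the heights `(m + 1) * (N + j) + l j`, `0 ≤ j < k`, with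
`r > l 0 > ⋯ > l (k - 1) ≥ 0`, by recursion on `k` along the choice of `l 0`. -/
def fallSum (m : ℕ) (α : ℕ → ℝ) : ℕ → ℕ → ℕ → ℝ
  | _, _, 0 => 1
  | N, r, k + 1 => ∑ a ∈ Finset.range r, alphaZero m α ((m + 1) * N + a) * fallSum m α (N + 1) a k

lemma fallSum_zero (m : ℕ) (α : ℕ → ℝ) (N r : ℕ) : fallSum m α N r 0 = 1 := rfl

lemma fallSum_succ_succ (m : ℕ) (α : ℕ → ℝ) (N r k : ℕ) :
    fallSum m α N (r + 1) (k + 1) = fallSum m α N r (k + 1) +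
      alphaZero m α ((m + 1) * N + r) * fallSum m α (N + 1) r k := by
  rw [fallSum, Finset.sum_range_succ, ← fallSum]

lemma fallSum_eq_zero_of_lt (m : ℕ) (α : ℕ → ℝ) {N r k : ℕ} (h : r < k) :
    fallSum m α N r k = 0 := by
  induction k generalizing N r with
  | zero => omega
  | succ k ih =>
    refine Finset.sum_eq_zero fun a ha => ?_
    rw [ih (by rw [Finset.mem_range] at ha; omega), mul_zero]

/-- The first `m` heights allow no fall. -/
lemma fallSum_zero_left (m : ℕ) (α : ℕ → ℝ) {r : ℕ} (hr : r ≤ m) (k : ℕ) :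
    fallSum m α 0 r (k + 1) = 0 := by
  refine Finset.sum_eq_zero fun a ha => ?_
  rw [Finset.mem_range] at ha
  rw [alphaZero, if_pos (by omega), zero_mul]

open Classical in
lemma sum_strictAnti_eq_fallSum (m : ℕ) (α : ℕ → ℝ) {N r k : ℕ} (hr : r ≤ m + 1) :
    ∑ l : Fin k → Fin (m + 1) with StrictAnti l ∧ ∀ j, (l j).val < r,
      ∏ j : Fin k, alphaZero m α ((m + 1) * (N + j.val) + (l j).val) = fallSum m α N r k := by
  induction k generalizing N r with
  | zero =>
    rw [fallSum_zero, Finset.sum_filter]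
    simp [Subsingleton.strictAnti]
  | succ k ih =>
    have hcons (a : Fin (m + 1)) (l : Fin k → Fin (m + 1)) :
        (StrictAnti (Fin.cons a l : Fin (k + 1) → Fin (m + 1)) ∧
          ∀ j, ((Fin.cons a l : Fin (k + 1) → Fin (m + 1)) j).val < r) ↔
        a.val < r ∧ StrictAnti l ∧ ∀ j, (l j).val < a.val := by
      constructor
      · rintro ⟨h1, h2⟩
        refine ⟨by simpa using h2 0, fun i j hij => ?_, fun j => ?_⟩
        · simpa using h1 (Fin.succ_lt_succ_iff.2 hij)
        · simpa using h1 (Fin.succ_pos j)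
      · rintro ⟨h1, h2, h3⟩
        refine ⟨fun i j => ?_, Fin.cases (by simpa using h1) fun j => by
          simpa using (h3 j).trans h1⟩
        refine Fin.cases (fun hj => ?_) (fun i => ?_) i
        · obtain ⟨j, rfl⟩ := Fin.exists_succ_eq_of_ne_zero hj.ne'
          simpa using h3 j
        · refine Fin.cases (fun h => by simp at h) (fun j h => ?_) j
          simpa using h2 (Fin.succ_lt_succ_iff.1 h)
    rw [Finset.sum_filter, ← (Fin.consEquiv fun _ => Fin (m + 1)).sum_comp,
      Fintype.sum_prod_type]
    have inner (a : Fin (m + 1)) :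
        ∑ l : Fin k → Fin (m + 1),
          (if StrictAnti (Fin.cons a l : Fin (k + 1) → Fin (m + 1)) ∧
              ∀ j, ((Fin.cons a l : Fin (k + 1) → Fin (m + 1)) j).val < r then
            ∏ j : Fin (k + 1), alphaZero m α ((m + 1) * (N + j.val) +
              ((Fin.cons a l : Fin (k + 1) → Fin (m + 1)) j).val) else 0) =
          if a.val < r then
            alphaZero m α ((m + 1) * N + a.val) * fallSum m α (N + 1) a.val k else 0 := by
      simp only [hcons]
      split_ifs with ha
      · rw [← ih (N := N + 1) (by omega : a.val ≤ m + 1), Finset.mul_sum, Finset.sum_filter]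
        refine Finset.sum_congr rfl fun l _ => ?_
        simp only [ha, true_and, Fin.prod_univ_succ, Fin.cons_zero, Fin.cons_succ, Fin.val_zero,
          add_zero, Fin.val_succ, add_assoc, add_comm 1]
      · simp [ha]
    refine (Finset.sum_congr rfl fun a _ => inner a).trans ?_
    rw [fallSum, Fin.sum_univ_eq_sum_range
      (fun a => if a < r then alphaZero m α ((m + 1) * N + a) * fallSum m α (N + 1) a k else 0),
      ← Finset.sum_filter]
    congr 1
    ext a
    simp only [Finset.mem_filter, Finset.mem_range]
    omega

lemma gammaCoeff_eq_fallSum (m : ℕ) (α : ℕ → ℝ) (N k : ℕ) :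
    gammaCoeff m α N k = fallSum m α N (m + 1) (k + 1) := by
  classical
  rw [← sum_strictAnti_eq_fallSum m α le_rfl, gammaCoeff]
  congr 1
  ext l
  simp [Fin.is_le]

lemma alphaZero_nonneg {m : ℕ} {α : ℕ → ℝ} (hα : ∀ k : ℕ, 0 < α (k + m)) (j : ℕ) :
    0 ≤ alphaZero m α j := by
  unfold alphaZero
  split_ifs with h
  · rfl
  · exact (pos_of_le hα (not_lt.1 h)).le

lemma alphaZero_of_le {m : ℕ} (α : ℕ → ℝ) {j : ℕ} (h : m ≤ j) : alphaZero m α j = α j :=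
  if_neg h.not_gt

lemma gammaCoeff_pos {m : ℕ} {α : ℕ → ℝ} (hα : ∀ k : ℕ, 0 < α (k + m)) (n : ℕ) {k : ℕ}
    (hk : k ≤ m) : 0 < gammaCoeff m α n k := by
  classical
  refine Finset.sum_pos' (fun l _ => Finset.prod_nonneg fun j _ => alphaZero_nonneg hα _)
    ⟨fun j => ⟨m - j.val, by omega⟩, ?_, Finset.prod_pos fun j _ => ?_⟩
  · simp only [Finset.mem_filter, Finset.mem_univ, true_and]
    intro i j hij
    rw [Fin.lt_def] at hij ⊢
    simp only
    omega
  · have h : m ≤ (m + 1) * (n + j.val) + (m - j.val) := by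
      have : n + j.val ≤ (m + 1) * (n + j.val) := Nat.le_mul_of_pos_left _ m.succ_pos
      omega
    rw [alphaZero_of_le α h]
    exact pos_of_le hα h

lemma gammaCoeff_eq_zero_of_lt {m : ℕ} (α : ℕ → ℝ) (n : ℕ) {k : ℕ} (hk : m < k) :
    gammaCoeff m α n k = 0 := by
  rw [gammaCoeff_eq_fallSum, fallSum_eq_zero_of_lt m α (by omega)]

/-- The paths that start at height `(m + 1) * n`, sorted by the number `s` of falls among their
first `r` steps. -/
lemma heightPoly_zero_eq_sum_fallSum (m : ℕ) (α : ℕ → ℝ) (n : ℕ) {r : ℕ} (hr : r ≤ m) :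
    heightPoly m α n 0 =
      ∑ s ∈ Finset.range (n + 1), C (fallSum m α (n + 1 - s) r s) * heightPoly m α (n - s) r := by
  induction r with
  | zero =>
    rw [Finset.sum_range_succ']
    rw [Finset.sum_eq_zero fun s _ => by rw [fallSum_eq_zero_of_lt m α s.succ_pos]; simp]
    simp [fallSum_zero]
  | succ r ih =>
    have hstep : ∀ s ∈ Finset.range n,
        C (fallSum m α (n + 1 - s) r s) * heightPoly m α (n - s) r =
        C (fallSum m α (n + 1 - s) r s) * heightPoly m α (n - s) (r + 1) +
        C (alphaZero m α ((m + 1) * (n - s) + r) * fallSum m α (n - s + 1) r s) *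
          heightPoly m α (n - (s + 1)) (r + 1) := by
      intro s hs
      rw [Finset.mem_range] at hs
      obtain ⟨d, rfl⟩ : ∃ d, n = s + 1 + d := ⟨n - (s + 1), by omega⟩
      have e1 : s + 1 + d - s = d + 1 := by omega
      have e2 : s + 1 + d + 1 - s = d + 2 := by omega
      have e3 : s + 1 + d - (s + 1) = d := by omega
      rw [e1, e2, e3, heightPoly_succ_succ, alphaZero_of_le α (by nlinarith), C_mul]
      ring
    rw [ih (by omega), Finset.sum_range_succ, Finset.sum_congr rfl hstep,
      Finset.sum_add_distrib, Nat.sub_self, heightPoly_zero, ← heightPoly_zero m α (r + 1),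
      add_right_comm]
    have hsum := Finset.sum_range_succ
      (fun s => C (fallSum m α (n + 1 - s) r s) * heightPoly m α (n - s) (r + 1)) n
    rw [Nat.sub_self] at hsum
    rw [← hsum, Finset.sum_range_succ', Finset.sum_range_succ', add_right_comm,
      ← Finset.sum_add_distrib]
    congr 1
    refine Finset.sum_congr rfl fun s hs => ?_
    rw [Finset.mem_range] at hs
    have e : n + 1 - (s + 1) = n - s := by omega
    rw [e, fallSum_succ_succ, C_add]
    ring

lemma X_mul_heightPoly_zero (m : ℕ) (α : ℕ → ℝ) (n : ℕ) :
    X * heightPoly m α n 0 = heightPoly m α (n + 1) 0 +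
      ∑ k ∈ Finset.range (min m n + 1),
        C (gammaCoeff m α (n - k) k) * heightPoly m α (n - k) 0 := by
  have hcut : ∑ k ∈ Finset.range (min m n + 1),
        C (gammaCoeff m α (n - k) k) * heightPoly m α (n - k) 0 =
      ∑ k ∈ Finset.range (n + 1), C (gammaCoeff m α (n - k) k) * heightPoly m α (n - k) 0 := by
    refine Finset.sum_subset (Finset.range_subset_range.2 (by omega)) fun k h1 h2 => ?_
    rw [Finset.mem_range] at h1 h2
    rw [gammaCoeff_eq_zero_of_lt α _ (by omega)]
    simp
  have hstep : ∀ s ∈ Finset.range (n + 1),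
      X * (C (fallSum m α (n + 1 - s) m s) * heightPoly m α (n - s) m) =
      C (fallSum m α (n + 1 - s) m s) * heightPoly m α (n + 1 - s) 0 +
      C (alphaZero m α ((m + 1) * (n - s) + m) * fallSum m α (n - s + 1) m s) *
        heightPoly m α (n - s) 0 := by
    intro s hs
    rw [Finset.mem_range] at hs
    have e : n + 1 - s = n - s + 1 := by omega
    rw [e, heightPoly_succ_zero, alphaZero_of_le α (by omega), C_mul]
    ring
  rw [hcut, heightPoly_zero_eq_sum_fallSum m α n le_rfl, Finset.mul_sum,
    Finset.sum_congr rfl hstep, Finset.sum_add_distrib]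
  have h0 : ∑ s ∈ Finset.range (n + 1),
      C (fallSum m α (n + 1 - s) m s) * heightPoly m α (n + 1 - s) 0 =
      heightPoly m α (n + 1) 0 + ∑ s ∈ Finset.range (n + 1),
        C (fallSum m α (n - s) m (s + 1)) * heightPoly m α (n - s) 0 := by
    rw [Finset.sum_range_succ', Finset.sum_range_succ _ n, Nat.sub_self,
      fallSum_zero_left m α le_rfl, fallSum_zero]
    simp only [Nat.add_sub_add_right]
    simp [add_comm]
  rw [h0, add_assoc, ← Finset.sum_add_distrib]
  congr 1
  refine Finset.sum_congr rfl fun s _ => ?_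
  rw [gammaCoeff_eq_fallSum, fallSum_succ_succ, C_add]
  ring


/-! ### Orthogonality on the step-line -/

/-- For a multi-index on the step-line, the orthogonality conditions `(j, k)` are among those with
`m * k + j < n`; by `exists_onStepLine` none of these is missing. -/
lemma mul_add_lt_of_onStepLine {m : ℕ} {v : Fin m → ℕ} (hv : OnStepLine v) {j : Fin m} {k : ℕ}
    (hk : k < v j) : m * k + j.val < ∑ i, v i := by
  have h1 : ∑ _i : Fin m, (k + 1) ≤ ∑ i, (v i + if j < i then 1 else 0) := by
    refine Finset.sum_le_sum fun i _ => ?_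
    split_ifs with h
    · have := (hv j i h.le).2
      omega
    · have := (hv i j (not_lt.1 h)).1
      omega
  rw [Finset.sum_const, Finset.card_univ, Fintype.card_fin, smul_eq_mul, Finset.sum_add_distrib,
    ← Finset.card_filter, Finset.filter_lt_eq_Ioi, Fin.card_Ioi] at h1
  have := j.isLt
  rw [mul_add] at h1
  omega

lemma exists_onStepLine {m : ℕ} (hm : 0 < m) (n : ℕ) :
    ∃ v : Fin m → ℕ, OnStepLine v ∧ ∑ i, v i = n ∧
      ∀ (j : Fin m) (k : ℕ), m * k + j.val < n → k < v j := by
  refine ⟨fun j => n / m + if j.val < n % m then 1 else 0, fun i j hij => ?_, ?_, fun j k h => ?_⟩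
  · rw [Fin.le_def] at hij
    dsimp only
    split_ifs <;> omega
  · have hlt := Nat.mod_lt n hm
    rw [Finset.sum_add_distrib, ← Finset.card_filter, Finset.sum_const, Finset.card_univ,
      Fintype.card_fin, smul_eq_mul,
      show (Finset.univ.filter fun j : Fin m => j.val < n % m) = Finset.Iio ⟨n % m, hlt⟩ by
        ext j; simp [Fin.lt_def], Fin.card_Iio]
    exact Nat.div_add_mod n m
  · have hd := Nat.div_add_mod n m
    dsimp only
    by_contra! hc
    split_ifs at hc with h1
    · have := Nat.mul_le_mul_left m hc
      rw [mul_add] at this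
      have := Nat.mod_lt n hm
      omega
    · have := Nat.mul_le_mul_left m hc
      rw [add_zero] at this
      omega

/-- Let `L` vanish on `P n` for `n > k` but not on `P k`. Under an `(m + 2)`-term recurrence whose
last coefficients do not vanish, multiplication by `X ^ i` moves the threshold `k` by `m * i`. -/
lemma apply_X_pow_mul_of_recurrence {m : ℕ} {P : ℕ → ℝ[X]} {γ : ℕ → ℕ → ℝ}
    (hrec : ∀ n, X * P n = P (n + 1) +
      ∑ k ∈ Finset.range (min m n + 1), C (γ (n - k) k) * P (n - k))
    (hγ : ∀ n, γ n m ≠ 0) {L : ℝ[X] →ₗ[ℝ] ℝ} {k : ℕ} (h0 : ∀ n, k < n → L (P n) = 0)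
    (h1 : L (P k) ≠ 0) (i : ℕ) :
    (∀ n, m * i + k < n → L (X ^ i * P n) = 0) ∧ L (X ^ i * P (m * i + k)) ≠ 0 := by
  have hL (i n : ℕ) : L (X ^ (i + 1) * P n) = L (X ^ i * P (n + 1)) +
      ∑ l ∈ Finset.range (min m n + 1), γ (n - l) l * L (X ^ i * P (n - l)) := by
    rw [pow_succ, mul_assoc, hrec, mul_add, Finset.mul_sum, map_add, map_sum]
    congr 1
    refine Finset.sum_congr rfl fun l _ => ?_
    rw [mul_left_comm, ← smul_eq_C_mul, map_smul, smul_eq_mul]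
  induction i with
  | zero => simpa using ⟨h0, h1⟩
  | succ i ih =>
    constructor
    · intro n hn
      rw [mul_add, mul_one] at hn
      rw [hL, ih.1 _ (by omega), zero_add]
      refine Finset.sum_eq_zero fun l hl => ?_
      rw [Finset.mem_range] at hl
      rw [ih.1 _ (by omega), mul_zero]
    · rw [hL, ih.1 _ (by rw [mul_add]; omega), zero_add, mul_add, mul_one,
        Nat.min_eq_left (by omega), Finset.sum_range_succ,
        Finset.sum_eq_zero fun l hl => ?_, zero_add]
      · rw [show m * i + m + k - m = m * i + k by omega]
        exact mul_ne_zero (hγ _) ih.2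
      · rw [Finset.mem_range] at hl
        rw [ih.1 _ (by omega), mul_zero]

lemma exists_eq_sum_of_degree_lt {P : ℕ → ℝ[X]} (hP : ∀ n, (P n).Monic ∧ (P n).natDegree = n)
    (n : ℕ) {D : ℝ[X]} (hD : D.degree < n) :
    ∃ c : ℕ → ℝ, D = ∑ l ∈ Finset.range n, C (c l) * P l := by
  induction n generalizing D with
  | zero => exact ⟨0, by simpa [Nat.WithBot.lt_zero_iff] using hD⟩
  | succ n ih =>
    have hlt : (D - C (D.coeff n) * P n).degree < n := by
      rw [degree_lt_iff_coeff_zero]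
      intro k hk
      rw [coeff_sub, coeff_C_mul]
      rcases hk.eq_or_lt with rfl | hk
      · have : (P n).coeff n = 1 := by
          have := (hP n).1.coeff_natDegree
          rwa [(hP n).2] at this
        rw [this]
        ring
      · rw [coeff_eq_zero_of_degree_lt (hD.trans_le (by exact_mod_cast hk)),
          coeff_eq_zero_of_natDegree_lt ((hP n).2.trans_lt hk)]
        ring
    obtain ⟨c, hc⟩ := ih hlt
    refine ⟨Function.update c n (D.coeff n), ?_⟩
    rw [Finset.sum_range_succ, Function.update_self, ← sub_eq_iff_eq_add, hc]
    refine Finset.sum_congr rfl fun l hl => ?_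
    rw [Function.update_of_ne (Finset.mem_range.1 hl).ne]

/-- The step-line conditions determine the sequence, and do not depend on the system of functionals
as long as it is triangular on `P`. -/
lemma isDOrthogonal_iff_eq {m : ℕ} (hm : 0 < m) {P : ℕ → ℝ[X]}
    (hP : ∀ n, (P n).Monic ∧ (P n).natDegree = n) {γ : ℕ → ℕ → ℝ}
    (hrec : ∀ n, X * P n = P (n + 1) +
      ∑ k ∈ Finset.range (min m n + 1), C (γ (n - k) k) * P (n - k))
    (hγ : ∀ n, γ n m ≠ 0) {L : Fin m → ℝ[X] →ₗ[ℝ] ℝ} (h0 : ∀ k n, k.val < n → L k (P n) = 0)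
    (h1 : ∀ k, L k (P k.val) ≠ 0) (Q : ℕ → ℝ[X]) :
    IsDOrthogonal (fun k => ⇑(L k)) Q ↔ Q = P := by
  have key (j : Fin m) (i : ℕ) := apply_X_pow_mul_of_recurrence hrec hγ (h0 j) (h1 j) i
  constructor
  · intro hQ
    funext n
    obtain ⟨v, hv, hsum, hlt⟩ := exists_onStepLine hm n
    obtain ⟨hmon, hdeg, horth⟩ := hQ v hv
    rw [hsum] at hmon hdeg horth
    dsimp only at horth
    have hD : (Q n - P n).degree < n := by
      have hd : (Q n).degree = (P n).degree := by
        rw [degree_eq_natDegree hmon.ne_zero, degree_eq_natDegree (hP n).1.ne_zero, hdeg, (hP n).2]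
      have := degree_sub_lt_left hd hmon.ne_zero (by rw [hmon.leadingCoeff, (hP n).1.leadingCoeff])
      rwa [degree_eq_natDegree hmon.ne_zero, hdeg] at this
    obtain ⟨c, hc⟩ := exists_eq_sum_of_degree_lt hP n hD
    have hzero : ∀ l < n, c l = 0 := by
      intro l
      induction l using Nat.strong_induction_on with
      | _ l ih =>
      intro hl
      -- The functional number `l` of the triangular system.
      let j : Fin m := ⟨l % m, Nat.mod_lt l hm⟩
      have hjl : m * (l / m) + j.val = l := Nat.div_add_mod l m
      obtain ⟨k1, k2⟩ := key j (l / m)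
      rw [hjl] at k1 k2
      have e : L j (X ^ (l / m) * (Q n - P n)) = 0 := by
        rw [mul_sub, map_sub, k1 n hl, horth j (l / m) (hlt j _ (by omega)), sub_zero]
      rw [hc, Finset.mul_sum, map_sum, Finset.sum_eq_single l] at e
      · rw [mul_left_comm, ← smul_eq_C_mul, map_smul, smul_eq_mul] at e
        exact (mul_eq_zero.1 e).resolve_right k2
      · intro i hi hil
        rw [mul_left_comm, ← smul_eq_C_mul, map_smul, smul_eq_mul]
        rcases lt_or_gt_of_ne hil with h | h
        · rw [ih i h (Finset.mem_range.1 hi), zero_mul]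
        · rw [k1 i h, mul_zero]
      · intro h
        exact absurd (Finset.mem_range.2 hl) h
    rw [← sub_eq_zero, hc]
    refine Finset.sum_eq_zero fun l hl => ?_
    rw [hzero l (Finset.mem_range.1 hl), C_0, zero_mul]
  · rintro rfl v hv
    exact ⟨(hP _).1, (hP _).2, fun j k hk => (key j k).1 _ (mul_add_lt_of_onStepLine hv hk)⟩


/-! ### Duality between paths and polynomials -/

/-- `heightPoly` indexed by the height. -/
def heightPolyAt (m : ℕ) (α : ℕ → ℝ) (h : ℕ) : ℝ[X] :=
  heightPoly m α (h / (m + 1)) (h % (m + 1))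

lemma heightPolyAt_mul_add (m : ℕ) (α : ℕ → ℝ) (n : ℕ) {r : ℕ} (hr : r ≤ m) :
    heightPolyAt m α ((m + 1) * n + r) = heightPoly m α n r := by
  rw [heightPolyAt, Nat.mul_add_div m.succ_pos, Nat.mul_add_mod, Nat.mod_eq_of_lt (by omega),
    Nat.div_eq_of_lt (by omega), add_zero]

/-- Multiplication by `X` becomes a single step of a path; the factor `X` is spent on the steps
that arrive at a multiple of `m + 1`. -/
lemma X_pow_mul_heightPolyAt (m : ℕ) (α : ℕ → ℝ) (h : ℕ) :
    X ^ (if m + 1 ∣ h + 1 then 1 else 0) * heightPolyAt m α h =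
      heightPolyAt m α (h + 1) +
        if h < m then 0 else C (α h) * heightPolyAt m α (h - m) := by
  obtain ⟨n, r, hr, rfl⟩ : ∃ n r, r ≤ m ∧ h = (m + 1) * n + r :=
    ⟨h / (m + 1), h % (m + 1), Nat.lt_succ_iff.1 (Nat.mod_lt _ m.succ_pos),
      (Nat.div_add_mod h (m + 1)).symm⟩
  have hdvd : m + 1 ∣ (m + 1) * n + r + 1 ↔ r = m := by
    rw [add_assoc, Nat.dvd_add_right (Nat.dvd_mul_right _ _)]
    refine ⟨fun H => ?_, fun H => by rw [H]⟩
    have := Nat.le_of_dvd r.succ_pos H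
    omega
  simp only [hdvd]
  rw [heightPolyAt_mul_add m α n hr]
  rcases hr.eq_or_lt with rfl | hlt
  · rw [if_pos rfl, if_neg (by omega), Nat.add_sub_cancel,
      show (r + 1) * n + r + 1 = (r + 1) * (n + 1) + 0 by ring,
      heightPolyAt_mul_add r α (n + 1) (Nat.zero_le r), heightPoly_succ_zero]
    have := heightPolyAt_mul_add r α n (Nat.zero_le r)
    rw [add_zero] at this
    rw [this]
    ring
  · rw [if_neg hlt.ne, pow_zero, one_mul, add_assoc _ r 1, heightPolyAt_mul_add m α n hlt]
    cases n with
    | zero => simp [heightPoly_zero, hlt]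
    | succ n =>
      have e : (m + 1) * (n + 1) + r - m = (m + 1) * n + (r + 1) := by
        rw [mul_add]
        omega
      rw [e, heightPolyAt_mul_add m α n hlt, heightPoly_succ_succ, if_neg (by nlinarith)]
      ring

lemma X_pow_eq_sum_dyckSum (m : ℕ) (α : ℕ → ℝ) (N : ℕ) :
    (X : ℝ[X]) ^ (N / (m + 1)) =
      ∑ h ∈ Finset.range (N + 1), C (dyckSum m α N h) * heightPolyAt m α h := by
  induction N with
  | zero => simp [dyckSum_self, heightPolyAt, heightPoly_zero]
  | succ N ih =>
    have hterm (h : ℕ) : X ^ (if m + 1 ∣ N + 1 then 1 else 0) *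
        (C (dyckSum m α N h) * heightPolyAt m α h) = C (dyckSum m α N h) *
        (heightPolyAt m α (h + 1) + if h < m then 0 else C (α h) * heightPolyAt m α (h - m)) := by
      by_cases hN : h ≡ N [MOD m + 1]
      · rw [← X_pow_mul_heightPolyAt, mul_left_comm]
        simp only [(hN.add_right 1).dvd_iff dvd_rfl]
      · simp [dyckSum_eq_zero_of_not_modEq m α hN]
    have hfall : ∑ h ∈ Finset.range (N + 1), C (dyckSum m α N h) *
        (if h < m then 0 else C (α h) * heightPolyAt m α (h - m)) =
        ∑ h ∈ Finset.range (N + 2), C (α (h + m) * dyckSum m α N (h + m)) * heightPolyAt m α h := by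
      trans ∑ h ∈ Finset.range (m + (N + 2)), C (dyckSum m α N h) *
        (if h < m then 0 else C (α h) * heightPolyAt m α (h - m))
      · refine Finset.sum_subset (Finset.range_subset_range.2 (by omega)) fun h _ h2 => ?_
        rw [Finset.mem_range] at h2
        rw [dyckSum_eq_zero_of_lt m α (by omega), C_0, zero_mul]
      · rw [Finset.sum_range_add, Finset.sum_eq_zero fun h hh => ?_, zero_add]
        · refine Finset.sum_congr rfl fun h _ => ?_
          rw [if_neg (by omega), Nat.add_sub_cancel_left, add_comm m h, C_mul]
          ring
        · rw [if_pos (Finset.mem_range.1 hh), mul_zero]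
    rw [Nat.succ_div, pow_add, mul_comm, ih, Finset.mul_sum,
      Finset.sum_congr rfl fun h _ => hterm h]
    simp only [mul_add]
    rw [Finset.sum_add_distrib, hfall, Finset.sum_range_succ' _ (N + 1),
      Finset.sum_range_succ' _ (N + 1),
      ← add_assoc, ← Finset.sum_add_distrib, zero_add, ← dyckSum_succ_zero]
    congr 1
    refine Finset.sum_congr rfl fun h _ => ?_
    rw [dyckSum_succ_succ, C_add]
    ring

/-- A functional whose moments count paths ending at height `K` is dual to `heightPolyAt` at the
heights congruent to `K` modulo `m + 1`. -/
lemma apply_heightPolyAt (m : ℕ) (α : ℕ → ℝ) (K : ℕ) (L : ℝ[X] →ₗ[ℝ] ℝ)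
    (hL : ∀ N, N ≡ K [MOD m + 1] → L (X ^ (N / (m + 1))) = dyckSum m α N K) (N : ℕ)
    (hN : N ≡ K [MOD m + 1]) : L (heightPolyAt m α N) = if N = K then 1 else 0 := by
  induction N using Nat.strong_induction_on with
  | _ N ih =>
  have h := hL N hN
  rw [X_pow_eq_sum_dyckSum m α, map_sum] at h
  simp only [← smul_eq_C_mul, map_smul, smul_eq_mul] at h
  rw [Finset.sum_range_succ, dyckSum_self, one_mul] at h
  have hterm : ∀ i ∈ Finset.range N, dyckSum m α N i * L (heightPolyAt m α i) =
      if i = K then dyckSum m α N K else 0 := by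
    intro i hi
    by_cases hiN : i ≡ N [MOD m + 1]
    · rw [ih i (Finset.mem_range.1 hi) (hiN.trans hN)]
      split_ifs with hK
      · rw [hK, mul_one]
      · rw [mul_zero]
    · rw [dyckSum_eq_zero_of_not_modEq m α hiN, zero_mul, if_neg]
      rintro rfl
      exact hiN hN.symm
  rw [Finset.sum_congr rfl hterm, Finset.sum_ite_eq'] at h
  simp only [Finset.mem_range] at h
  rcases lt_trichotomy N K with hlt | rfl | hgt
  · rw [if_neg (by omega), zero_add, dyckSum_eq_zero_of_lt m α hlt] at h
    rw [h, if_neg (by omega)]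
  · rw [if_neg (by omega), zero_add, dyckSum_self] at h
    rw [h, if_pos rfl]
  · rw [if_pos hgt] at h
    rw [if_neg (by omega)]
    linarith

lemma apply_of_generalisedSR (m : ℕ) (α : ℕ → ℝ) (k : ℕ) (L : ℝ[X] →ₗ[ℝ] ℝ)
    (hL : ∀ n, L (X ^ n) = generalisedSR m α n k) (n : ℕ) :
    L (heightPoly m α n 0) = if n = k then 1 else 0 := by
  have h := apply_heightPolyAt m α ((m + 1) * k) L (fun N hN => ?_) ((m + 1) * n) ?_
  · rw [← add_zero ((m + 1) * n), heightPolyAt_mul_add m α n (Nat.zero_le m), add_zero] at h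
    simpa using h
  · obtain ⟨n, rfl⟩ : m + 1 ∣ N := (hN.dvd_iff dvd_rfl).2 (Nat.dvd_mul_right _ _)
    rw [Nat.mul_div_cancel_left _ m.succ_pos, hL, generalisedSR]
  · simp [Nat.ModEq]

/-- Descending from the residue `k` to the residue `0`, where the modified moments are triangular
rather than dual. -/
lemma apply_of_modifiedSR {m : ℕ} {α : ℕ → ℝ} (hα : ∀ k : ℕ, 0 < α (k + m)) {k : ℕ} (hk : k < m)
    (L : ℝ[X] →ₗ[ℝ] ℝ) (hL : ∀ n, L (X ^ n) = modifiedSR m α n k) :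
    (∀ n, k < n → L (heightPoly m α n 0) = 0) ∧ 0 < L (heightPoly m α k 0) := by
  have hdual (n : ℕ) : L (heightPoly m α n k) = if n = 0 then 1 else 0 := by
    have h := apply_heightPolyAt m α k L (fun N hN => ?_) ((m + 1) * n + k) (by simp [Nat.ModEq])
    · rw [heightPolyAt_mul_add m α n hk.le] at h
      simpa using h
    · have e : N = (m + 1) * (N / (m + 1)) + k := by
        have h1 := Nat.div_add_mod N (m + 1)
        have h2 : N % (m + 1) = k := Eq.trans hN (Nat.mod_eq_of_lt (by omega))
        omega
      rw [hL, modifiedSR, ← e]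
  have key : ∀ r ≤ k, (∀ n, r < n → L (heightPoly m α n (k - r)) = 0) ∧
      0 < L (heightPoly m α r (k - r)) := by
    intro r
    induction r with
    | zero =>
      intro _
      refine ⟨fun n hn => ?_, ?_⟩
      · rw [Nat.sub_zero, hdual, if_neg (by omega)]
      · rw [Nat.sub_zero, hdual, if_pos rfl]
        exact one_pos
    | succ r ih =>
      intro hr
      obtain ⟨h0, h1⟩ := ih (by omega)
      have hstep (n : ℕ) : L (heightPoly m α (n + 1) (k - (r + 1))) =
          L (heightPoly m α (n + 1) (k - r)) +
            α ((m + 1) * (n + 1) + (k - (r + 1))) * L (heightPoly m α n (k - r)) := by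
        obtain ⟨d, hd⟩ : ∃ d, k - r = d + 1 := ⟨k - r - 1, by omega⟩
        rw [show k - (r + 1) = d by omega, hd, heightPoly_succ_succ, map_sub, ← smul_eq_C_mul,
          map_smul, smul_eq_mul]
        ring
      refine ⟨fun n hn => ?_, ?_⟩
      · obtain ⟨n, rfl⟩ : ∃ i, n = i + 1 := ⟨n - 1, by omega⟩
        rw [hstep, h0 _ (by omega), h0 _ (by omega)]
        simp
      · rw [hstep, h0 _ (by omega), zero_add]
        exact mul_pos (pos_of_le hα (by nlinarith)) h1
  simpa using key k le_rfl

/-- Linearity of `measureFunctional` rests on integrability: without it the Bochner integral takes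
the junk value `0`. -/
lemma exists_linearMap_measureFunctional {μ : Measure ℝ}
    (hμ : ∀ n : ℕ, Integrable (fun x : ℝ => x ^ n) μ) :
    ∃ L : ℝ[X] →ₗ[ℝ] ℝ, ⇑L = measureFunctional μ ∧ ∀ n, L (X ^ n) = ∫ x, x ^ n ∂μ := by
  have hint (p : ℝ[X]) : Integrable (fun x => p.eval x) μ := by
    simp only [eval_eq_sum_range]
    exact integrable_finsetSum _ fun i _ => (hμ i).const_mul _
  refine ⟨⟨⟨measureFunctional μ, fun p q => ?_⟩, fun c p => ?_⟩, rfl, fun n => ?_⟩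
  · simp only [measureFunctional, eval_add]
    exact integral_add (hint p) (hint q)
  · simp only [measureFunctional, eval_smul, smul_eq_mul, RingHom.id_apply]
    exact integral_const_mul _ _
  · change measureFunctional μ (X ^ n) = _
    simp [measureFunctional]

end BranchedCF

end

theorem mainTheorem3 (m : ℕ) (hm : 0 < m) (α : ℕ → ℝ) (hα : ∀ k : ℕ, 0 < α (k + m))
    (u : Fin m → (ℝ[X] →ₗ[ℝ] ℝ))
    (hu : ∀ (k : Fin m) (n : ℕ), u k (X ^ n) = BranchedCF.generalisedSR m α n k) :
    -- the `m`-orthogonal polynomial sequence with respect to `u` exists and is unique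
    (∃! P : ℕ → ℝ[X], BranchedCF.IsDOrthogonal (fun k => ⇑(u k)) P) ∧
    -- it is the one with respect to any measures that have the modified polynomials as moments
    (∀ μ : Fin m → Measure ℝ, (∀ k : Fin m, μ k (Set.Iio 0) = 0) →
      (∀ (k : Fin m) (n : ℕ), Integrable (fun x : ℝ => x ^ n) (μ k) ∧
        ∫ x, x ^ n ∂(μ k) = BranchedCF.modifiedSR m α n k) →
      ∀ P : ℕ → ℝ[X],
        BranchedCF.IsDOrthogonal (fun k => BranchedCF.measureFunctional (μ k)) P ↔
          BranchedCF.IsDOrthogonal (fun k => ⇑(u k)) P) ∧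
    ∀ P : ℕ → ℝ[X], BranchedCF.IsDOrthogonal (fun k => ⇑(u k)) P →
      -- all complex zeros are real, positive and simple
      (∀ (n : ℕ) (z : ℂ), ((P n).map (algebraMap ℝ ℂ)).IsRoot z →
        z.im = 0 ∧ 0 < z.re ∧ ((P n).map (algebraMap ℝ ℂ)).rootMultiplicity z = 1) ∧
      -- the zeros of consecutive polynomials interlace
      (∀ n : ℕ, BranchedCF.ZerosInterlace n (P n) (P (n + 1))) ∧
      -- the recurrence relation, and positivity of its coefficients
      P 0 = 1 ∧
      (∀ n : ℕ, P (n + 1) = X * P n -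
        ∑ k ∈ Finset.range (min m n + 1), C (BranchedCF.gammaCoeff m α (n - k) k) * P (n - k)) ∧
      (∀ n k : ℕ, k ≤ m → 0 < BranchedCF.gammaCoeff m α n k) := by
  open BranchedCF in
  have horth {L : Fin m → ℝ[X] →ₗ[ℝ] ℝ} (h0 : ∀ k n, k.val < n → L k (heightPoly m α n 0) = 0)
      (h1 : ∀ k : Fin m, L k (heightPoly m α k 0) ≠ 0) (Q : ℕ → ℝ[X]) :=
    isDOrthogonal_iff_eq hm (P := fun n => heightPoly m α n 0)
      (fun n => heightPoly_monic_and_natDegree m α n 0) (X_mul_heightPoly_zero m α)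
      (fun n => (gammaCoeff_pos hα n le_rfl).ne') h0 h1 Q
  have hu' (k : Fin m) := BranchedCF.apply_of_generalisedSR m α k (u k) (hu k)
  have hiff := horth (L := u) (fun k n h => by rw [hu', if_neg h.ne'])
    (fun k => by rw [hu', if_pos rfl]; exact one_ne_zero)
  refine ⟨⟨_, (hiff _).2 rfl, fun Q hQ => (hiff Q).1 hQ⟩, fun μ _ hμ P => ?_, fun P hP => ?_⟩
  · choose L hL hLX using fun k =>
      BranchedCF.exists_linearMap_measureFunctional fun n => (hμ k n).1
    have hL' (k : Fin m) := BranchedCF.apply_of_modifiedSR hα k.isLt (L k)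
      fun n => (hLX k n).trans (hμ k n).2
    simp only [← hL]
    exact (horth (fun k => (hL' k).1) (fun k => (hL' k).2.ne') P).trans (hiff P).symm
  · obtain rfl := (hiff P).1 hP
    refine ⟨fun n z => BranchedCF.complex_zeros_heightPoly hm hα n,
      BranchedCF.zerosInterlace_heightPoly hm hα, BranchedCF.heightPoly_zero m α 0, fun n => ?_,
      fun n k => BranchedCF.gammaCoeff_pos hα n⟩
    dsimp only
    rw [BranchedCF.X_mul_heightPoly_zero m α n, add_sub_cancel_right]
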